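/- Let $\Omega$ be the set of countable (nonzero) limit ordinals. A ladder system on $\omega_1$ is a sequence $\bar C=\langle C_\eta:\eta\in\Omega\rangle$ such that each $C_\eta$ is a cofinal subset of $\eta$ of order type $\omega$; write $C_\eta(i)$ for the $\alpha\in C_\eta$ with $|C_\eta\cap\alpha|=i$. A partial function $F\colon 2^\omega\to 2$ is dense if for every finite sequence $s\in 2^{<\omega}$ both values $0,1$ are attained by $F$ at points of $\operatorname{dom}(F)$ extending $s$. Given a ladder system $\bar C$ on $\omega_1$, a dense partial function $F\colon 2^\omega\to2$ and a function $g\colon\Omega\to2$, let $Q_{\bar C,F,g}$ be the set of functions $p\colon\delta_p\to 2$, with $\delta_p$ a countable ordinal, such that for every $\eta\in\Omega$ with $\eta\le\delta_p$ the sequence $\langle p(C_\eta(i)):i<\omega\rangle$ is in $\operatorname{dom}(F)$ and $F(\langle p(C_\eta(i)):i<\omega\rangle)=g(\eta)$, ordered by extension ($q\le p$ iff $q\supseteq p$). Then for all such $\bar C$, $F$, $g$ the partial order $P=Q_{\bar C,F,g}$ has the following properties. (1) $P$ is proper: for every regular uncountable cardinal $\theta>2^{|P|}$ with $P\in H(\theta)$,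 every countable elementary substructure $X\prec(H(\theta),\in)$ with $(P,\le)\in X$ and every $p\in P\cap X$, there is a $q\le p$ which is $(X,P)$-generic, i.e. for every dense $D\subseteq P$ with $D\in X$, every $r\le q$ is compatible with some element of $D\cap X$. (2) $P$ is $(\omega,\infty)$-distributive: the intersection of countably many dense open subsets of $P$ is dense. (3) In particular, forcing with $P$ adds no new elements of $\omega^\omega$: whenever $\dot x$ is a $P$-name and $q\in P$ forces $\dot x\in\omega^\omega$, there are $r\le q$ and $y\in\omega^\omega$ in the ground model such that $r$ forces $\dot x=\check y$. -/

import Mathlib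

universe u

namespace LadderForcing

open Ordinal Cardinal

/-! ### Ladder systems, dense partial functions and the forcing -/

/-- `Ω`: the set of countable (nonzero) limit ordinals. -/
def Omega : Set Ordinal.{0} := {η | Order.IsSuccLimit η ∧ η < ω₁}

/-- A ladder system on `ω₁`: each `C η` (`η ∈ Ω`) is a cofinal subset of `η` of order type `ω`. -/
structure LadderSystem where
  C : Omega → Set Ordinal.{0}
  subset : ∀ η : Omega, C η ⊆ Set.Iio (η : Ordinal)
  cofinal : ∀ η : Omega, ∀ α < (η : Ordinal), ∃ β ∈ C η, α ≤ β
  orderType : ∀ η : Omega, Nonempty (ℕ ≃o C η)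

/-- `C(n)`: the unique `α ∈ C` such that `C ∩ α` has exactly `n` elements. -/
noncomputable def nthElem (C : Set Ordinal.{0}) (n : ℕ) : Ordinal.{0} :=
  sInf {α | α ∈ C ∧ (C ∩ Set.Iio α).encard = n}

theorem nthElem_spec {C : Set Ordinal.{0}} (h : Nonempty (ℕ ≃o C)) (n : ℕ) :
    nthElem C n ∈ C ∧ (C ∩ Set.Iio (nthElem C n)).encard = n := by
  obtain ⟨e⟩ := h
  refine csInf_mem (s := {α | α ∈ C ∧ (C ∩ Set.Iio α).encard = n}) ⟨e n, (e n).2, ?_⟩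
  have : C ∩ Set.Iio (e n : Ordinal) = (fun k => (e k : Ordinal)) '' Set.Iio n := by
    ext x
    constructor
    · rintro ⟨hx, hlt⟩
      refine ⟨e.symm ⟨x, hx⟩, ?_, by simp⟩
      have : (⟨x, hx⟩ : C) < e n := hlt
      simpa using e.symm.lt_iff_lt.mpr this
    · rintro ⟨k, hk, rfl⟩
      exact ⟨(e k).2, e.lt_iff_lt.mpr hk⟩
  rw [this, Function.Injective.encard_image
    (f := fun k => (e k : Ordinal)) (Subtype.val_injective.comp e.injective),
    Set.encard_eq_coe_toFinset_card]
  simp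

theorem LadderSystem.nthElem_lt (L : LadderSystem) (η : Omega) (n : ℕ) :
    nthElem (L.C η) n < (η : Ordinal) :=
  L.subset η (nthElem_spec (L.orderType η) n).1

/-- The basic clopen set `[s]` of extensions in `2^ω` of a finite sequence `s ∈ 2^n`. -/
def cyl {n : ℕ} (s : Fin n → Fin 2) : Set (ℕ → Fin 2) := {x | ∀ i : Fin n, x i = s i}

/-- A partial function `F : 2^ω → 2` is dense if `F[[s] ∩ dom F] = 2` for every `s ∈ 2^{<ω}`. -/
def IsDenseFn (F : (ℕ → Fin 2) →. Fin 2) : Prop :=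
  ∀ (n : ℕ) (s : Fin n → Fin 2), F.image (cyl s) = Set.univ

/-- The conditions of `Q_{C,F,g}`: functions `p : δ → 2`, `δ` a countable ordinal, such that for all
`η ∈ (δ + 1) ∩ Ω` the sequence `⟨p (C_η(i)) : i < ω⟩` is in `dom F` and is mapped by `F` to `g η`. -/
@[ext]
structure Q (L : LadderSystem) (F : (ℕ → Fin 2) →. Fin 2) (g : Omega → Fin 2) where
  δ : Ordinal.{0}
  δ_lt : δ < ω₁
  toFun : Set.Iio δ → Fin 2
  coded : ∀ (η : Omega) (h : (η : Ordinal) ≤ δ),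
    g η ∈ F (fun i => toFun ⟨nthElem (L.C η) i, (L.nthElem_lt η i).trans_le h⟩)

/-- `q ≤ p` (`q` is the stronger condition) iff the function `q` extends the function `p`. -/
instance (L : LadderSystem) (F : (ℕ → Fin 2) →. Fin 2) (g : Omega → Fin 2) :
    PartialOrder (Q L F g) where
  le q p := ∃ h : p.δ ≤ q.δ, ∀ α : Set.Iio p.δ, q.toFun ⟨α, α.2.trans_le h⟩ = p.toFun α
  le_refl p := ⟨le_rfl, fun _ => rfl⟩
  le_trans r q p := fun ⟨h₁, e₁⟩ ⟨h₂, e₂⟩ =>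
    ⟨h₂.trans h₁, fun α => (e₁ ⟨α, α.2.trans_le h₂⟩).trans (e₂ α)⟩
  le_antisymm p q := fun ⟨h₁, e₁⟩ ⟨h₂, _⟩ => by
    obtain ⟨δ, hδ, f, hf⟩ := p
    obtain ⟨δ', hδ', f', hf'⟩ := q
    obtain rfl : δ = δ' := le_antisymm h₂ h₁
    obtain rfl : f = f' := funext e₁
    rfl

/-! ### Dense sets and distributivity of a forcing notion (smaller conditions are stronger) -/

section Forcing

variable {P : Type u} [Preorder P]

/-- `D` is dense below `p`. -/
def DenseBelow (D : Set P) (p : P) : Prop := ∀ q ≤ p, ∃ d ∈ D, d ≤ q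

/-- `D` is dense in the forcing notion `P`. -/
def DenseIn (D : Set P) : Prop := ∀ q : P, ∃ d ∈ D, d ≤ q

/-- Two conditions are compatible if they have a common extension. -/
def Compat (p q : P) : Prop := ∃ r, r ≤ p ∧ r ≤ q

variable (P) in
/-- `P` is `(ω, ∞)`-distributive: the intersection of countably many dense open subsets is dense. -/
def OmegaDistributive : Prop :=
  ∀ D : ℕ → Set P, (∀ n, DenseIn (D n) ∧ IsLowerSet (D n)) → DenseIn (⋂ n, D n)

/-! ### Names for reals

Every subset of `ω × ω` in a forcing extension by `P` has a name of the form
`{((n, m)ˇ, a) : a ∈ A n m}` with `A n m ⊆ P`; the family `A` stands for this name. -/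

/-- `q ⊩ (n, m) ∈ Ȧ`. -/
def ForcesMem (A : ℕ → ℕ → Set P) (q : P) (n m : ℕ) : Prop :=
  DenseBelow {r | ∃ a ∈ A n m, r ≤ a} q

/-- `q ⊩ Ȧ ∈ ω^ω`: it is forced that for every `n` there is exactly one `m` with `(n, m) ∈ Ȧ`. -/
def ForcesReal (A : ℕ → ℕ → Set P) (q : P) : Prop :=
  ∀ n, DenseBelow {r | ∃ m, ForcesMem A r n m} q ∧
    ∀ r ≤ q, ∀ m m', ForcesMem A r n m → ForcesMem A r n m' → m = m'

variable (P) in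
/-- `P` adds no new reals: whenever a condition `q` forces `Ȧ ∈ ω^ω`, some `r ≤ q` and some ground
model `y ∈ ω^ω` are such that `r ⊩ Ȧ = y`. -/
def AddsNoNewReals : Prop :=
  ∀ (A : ℕ → ℕ → Set P) (q : P), ForcesReal A q →
    ∃ r ≤ q, ∃ y : ℕ → ℕ, ∀ n, ForcesMem A r n (y n)

end Forcing

/-! ### `H(θ)` and properness -/

/-- The only symbol of the language of set theory: a binary relation symbol. -/
inductive SetRel : ℕ → Type
  | mem : SetRel 2

/-- The first-order language `{∈}` of set theory. -/
def langSet : FirstOrder.Language.{0, 0} := ⟨fun _ => Empty, SetRel⟩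

/-- `H(θ)`: the sets whose transitive closure (least transitive superset) has cardinality `< θ`. -/
def H (θ : Cardinal.{u}) : Set ZFSet.{u} :=
  {x | ∃ t : ZFSet.{u}, t.IsTransitive ∧ x ⊆ t ∧ t.card < θ}

/-- `H(θ)` as the structure `(H(θ), ∈)`. -/
instance (θ : Cardinal.{u}) : langSet.Structure (H θ) where
  funMap f := f.elim
  RelMap | .mem => fun v => (v 0 : ZFSet) ∈ (v 1 : ZFSet)

section Proper

variable {P : Type u} [Preorder P]

/-- The underlying set of the copy of `P` among the sets given by an injection `e`. -/
noncomputable def carrierSet (e : P ↪ ZFSet.{u}) : ZFSet.{u} := ZFSet.range e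

/-- The order, as a set of ordered pairs, of the copy of `P` given by an injection `e`. -/
noncomputable def leSet (e : P ↪ ZFSet.{u}) : ZFSet.{u} :=
  ZFSet.range fun z : {z : P × P // z.1 ≤ z.2} => ZFSet.pair (e z.1.1) (e z.1.2)

/-- `q` is `(X, P)`-generic: for every dense `D ⊆ P` with `D ∈ X`, the set `D ∩ X` is predense
below `q`. -/
def IsGenericCond (e : P ↪ ZFSet.{u}) (X : Set ZFSet.{u}) (q : P) : Prop :=
  ∀ D ∈ X, D ⊆ carrierSet e → DenseIn {p | e p ∈ D} →
    ∀ r ≤ q, ∃ d : P, e d ∈ D ∧ e d ∈ X ∧ Compat d r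

variable (P) in
/-- `P` is proper: for every regular uncountable `θ > 2^|P|` with `P ∈ H(θ)`, every countable
`X ≺ (H(θ), ∈)` with `P, ≤ ∈ X` and every `p ∈ P ∩ X` there is an `(X, P)`-generic `q ≤ p`.
Here `P` is regarded as a set by means of an arbitrary injection `e` of `P` into the universe
of sets. -/
def IsProper : Prop :=
  ∀ (e : P ↪ ZFSet.{u}) (θ : Cardinal.{u}), θ.IsRegular → ℵ₀ < θ → 2 ^ #P < θ →
    carrierSet e ∈ H θ →
    ∀ X : langSet.ElementarySubstructure (H θ),
      let X' : Set ZFSet.{u} := Subtype.val '' (X : Set (H θ))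
      X'.Countable → carrierSet e ∈ X' → leSet e ∈ X' →
        ∀ p : P, e p ∈ X' → ∃ q ≤ p, IsGenericCond e X' q

end Proper

end LadderForcing

namespace LadderForcing

open Ordinal Cardinal FirstOrder

/-! ### Enumerating ladders -/

namespace LadderSystem

variable (L : LadderSystem) (η : Omega)

/-! Let `Y` be a countable set of conditions whose lengths have a limit supremum η not attained in
`Y`. A descending sequence in `Y` with lengths cofinal in η has a lower bound of length η once its
values along `C_η` form some `x` with `F x = g η`, since smaller limits are already coded. Density
of `F` supplies such an `x` agreeing with the finite part of the ladder that the starting condition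
decides. It remains to meet given dense sets without deviating from `x`.

A careless extension into a dense set `D` may run past ladder points with wrong values. The remedy
is a reservoir: a set `S ⊆ Y` in which `D` is dense, which allows restriction, one-step extension
and prolongation to any length occurring in it, and whose lengths are bounded by that of a member of
`Y`, hence below η. Only finitely many ladder points lie below this bound. Writing the values of `x`
at all those that `S` can reach comes first; a subsequent step into `D ∩ S` then meets no new ladder
point. This is `Q.exists_le_of_reservoirs`.

For distributivity, `Y` is a closure under the choice of reservoirs. For properness, `Y = P ∩ X`,
and `Q.exists_isReservoir_subset` finds the reservoirs by elementarity. Since `X` is only given `P`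
and `≤`, everything is expressed through them: one-step extensions are immediate predecessors,
equality of length is the unique solution of a back-and-forth recursion, and countability of `S`
becomes generation from one condition by a partial function, which forces `S ⊆ X`. -/

theorem nthElem_strictMono : StrictMono (nthElem (L.C η)) := by
  intro i j hij
  by_contra! h
  have hi := (nthElem_spec (L.orderType η) i).2
  have hj := (nthElem_spec (L.orderType η) j).2
  have : (j : ℕ∞) ≤ i := by
    rw [← hi, ← hj]
    exact Set.encard_le_encard (Set.inter_subset_inter_right _ (Set.Iio_subset_Iio h))
  exact absurd (by exact_mod_cast this) (not_le.2 hij)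

theorem finite_inter_Iio {β : Ordinal} (hβ : β ∈ L.C η) : (L.C η ∩ Set.Iio β).Finite := by
  obtain ⟨e⟩ := L.orderType η
  refine ((Set.finite_Iio (e.symm ⟨β, hβ⟩)).image fun k => (e k : Ordinal)).subset ?_
  rintro x ⟨hx, hlt⟩
  exact ⟨e.symm ⟨x, hx⟩, e.symm.lt_iff_lt.2 (Subtype.mk_lt_mk.2 hlt), by simp⟩

theorem exists_le_nthElem {α : Ordinal} (hα : α < η) : ∃ n, α ≤ nthElem (L.C η) n := by
  obtain ⟨β, hβ, hαβ⟩ := L.cofinal η α hα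
  by_contra! h
  have hsub : Set.range (nthElem (L.C η)) ⊆ L.C η ∩ Set.Iio β := by
    rintro _ ⟨n, rfl⟩
    exact ⟨(nthElem_spec (L.orderType η) n).1, (h n).trans_le hαβ⟩
  exact Set.infinite_range_of_injective (L.nthElem_strictMono η).injective
    ((L.finite_inter_Iio η hβ).subset hsub)

theorem exists_forall_le_nthElem {α : Ordinal} (hα : α < η) :
    ∃ n, ∀ i, nthElem (L.C η) i < α ↔ i < n := by
  classical
  have h := L.exists_le_nthElem η hα
  refine ⟨Nat.find h, fun i => ⟨fun hi => ?_, fun hi => not_le.1 (Nat.find_min h hi)⟩⟩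
  by_contra! hn
  exact absurd hi (not_lt.2 ((Nat.find_spec h).trans ((L.nthElem_strictMono η).monotone hn)))

end LadderSystem

variable {L : LadderSystem} {F : (ℕ → Fin 2) →. Fin 2} {g : Omega → Fin 2}

/-! ### Conditions as total functions -/

namespace Q

open Classical in
/-- The value of a condition at `α`, with default value `0` outside its domain. -/
noncomputable def val (p : Q L F g) (α : Ordinal.{0}) : Fin 2 :=
  if h : α < p.δ then p.toFun ⟨α, h⟩ else 0

theorem val_of_lt (p : Q L F g) {α : Ordinal} (h : α < p.δ) : p.val α = p.toFun ⟨α, h⟩ :=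
  dif_pos h

theorem le_iff {q p : Q L F g} : q ≤ p ↔ p.δ ≤ q.δ ∧ ∀ α < p.δ, q.val α = p.val α := by
  constructor
  · rintro ⟨h, e⟩
    refine ⟨h, fun α hα => ?_⟩
    rw [val_of_lt _ hα, val_of_lt _ (hα.trans_le h)]
    exact e ⟨α, hα⟩
  · rintro ⟨h, e⟩
    refine ⟨h, fun α => ?_⟩
    have := e α α.2
    rwa [val_of_lt _ α.2, val_of_lt _ (lt_of_lt_of_le α.2 h)] at this

theorem coded_val (p : Q L F g) (η : Omega) (h : (η : Ordinal) ≤ p.δ) :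
    g η ∈ F fun i => p.val (nthElem (L.C η) i) := by
  have := p.coded η h
  convert this using 2
  funext i
  exact val_of_lt _ _

/-- The condition with domain `δ` given by a total function. -/
def ofFun (δ : Ordinal.{0}) (hδ : δ < ω₁) (f : Ordinal.{0} → Fin 2)
    (h : ∀ η : Omega, (η : Ordinal) ≤ δ → g η ∈ F fun i => f (nthElem (L.C η) i)) : Q L F g where
  δ := δ
  δ_lt := hδ
  toFun α := f α
  coded := h

theorem val_ofFun {δ : Ordinal.{0}} {hδ : δ < ω₁} {f : Ordinal.{0} → Fin 2}
    {h : ∀ η : Omega, (η : Ordinal) ≤ δ → g η ∈ F fun i => f (nthElem (L.C η) i)}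
    {α : Ordinal} (hα : α < δ) : (ofFun δ hδ f h : Q L F g).val α = f α :=
  val_of_lt _ hα

/-- The restriction of a condition to an ordinal below its domain. -/
noncomputable def restrict (p : Q L F g) (β : Ordinal.{0}) (hβ : β ≤ p.δ) : Q L F g :=
  ofFun β (hβ.trans_lt p.δ_lt) p.val fun η h => p.coded_val η (h.trans hβ)

theorem le_restrict (p : Q L F g) {β : Ordinal} (hβ : β ≤ p.δ) : p ≤ p.restrict β hβ :=
  le_iff.2 ⟨hβ, fun _ hα => (val_ofFun hα).symm⟩

theorem ext_val {p q : Q L F g} (hδ : p.δ = q.δ) (h : ∀ α < p.δ, p.val α = q.val α) : p = q :=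
  le_antisymm (le_iff.2 ⟨hδ.ge, fun α hα => h α (hα.trans_eq hδ.symm)⟩)
    (le_iff.2 ⟨hδ.le, fun α hα => (h α hα).symm⟩)

theorem eq_restrict {p q : Q L F g} (h : p ≤ q) : q = p.restrict q.δ (le_iff.1 h).1 :=
  ext_val rfl fun α hα => by
    rw [restrict, val_ofFun hα, (le_iff.1 h).2 α hα]

theorem lt_iff {q p : Q L F g} : q < p ↔ q ≤ p ∧ p.δ < q.δ := by
  refine ⟨fun h => ⟨h.le, lt_of_le_of_ne (le_iff.1 h.le).1 fun e => h.ne ?_⟩, fun h => ?_⟩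
  · exact ext_val e.symm fun α hα => (le_iff.1 h.le).2 α (hα.trans_eq e.symm)
  · exact lt_of_le_of_ne h.1 fun e => h.2.ne (e ▸ rfl)

/-- A one-step extension creates no new coding requirement, because its length is not a limit. -/
theorem isSuccLimit_le_add_one {η δ : Ordinal} (hη : Order.IsSuccLimit η) (h : η ≤ δ + 1) :
    η ≤ δ := by
  rcases h.lt_or_eq with h | rfl
  · exact Order.lt_add_one_iff.1 h
  · exact absurd hη (by rw [← Order.succ_eq_add_one]; exact Order.not_isSuccLimit_succ δ)

open Classical in
/-- The extension of a condition by one further value. -/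
noncomputable def snoc (p : Q L F g) (i : Fin 2) : Q L F g :=
  ofFun (p.δ + 1) ((isSuccLimit_omega 1).add_one_lt p.δ_lt)
    (fun α => if α < p.δ then p.val α else i) fun η h => by
      have h' := isSuccLimit_le_add_one η.2.1 h
      convert p.coded_val η h' using 2
      funext k
      exact if_pos ((L.nthElem_lt η k).trans_le h')

theorem snoc_δ (p : Q L F g) (i : Fin 2) : (p.snoc i).δ = p.δ + 1 := rfl

theorem snoc_le (p : Q L F g) (i : Fin 2) : p.snoc i ≤ p :=
  le_iff.2 ⟨le_self_add, fun α hα => by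
    rw [snoc, val_ofFun (hα.trans_le le_self_add), if_pos hα]⟩

theorem snoc_val (p : Q L F g) (i : Fin 2) : (p.snoc i).val p.δ = i := by
  rw [snoc, val_ofFun (Order.lt_add_one_iff.2 le_rfl), if_neg (lt_irrefl _)]

theorem snoc_lt (p : Q L F g) (i : Fin 2) : p.snoc i < p :=
  lt_iff.2 ⟨p.snoc_le i, Order.lt_add_one_iff.2 le_rfl⟩

theorem not_lt_lt_snoc (p : Q L F g) (i : Fin 2) : ¬∃ w, p.snoc i < w ∧ w < p := by
  rintro ⟨w, h₁, h₂⟩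
  have h₁ := (lt_iff.1 h₁).2
  have h₂ := (lt_iff.1 h₂).2
  exact absurd (Order.lt_add_one_iff.1 (snoc_δ p i ▸ h₁)) (not_le.2 h₂)

/-- Together with `not_lt_lt_snoc` this makes one-step extension definable from the order alone. -/
theorem exists_eq_snoc {p v : Q L F g} (h : v < p) (h' : ¬∃ w, v < w ∧ w < p) :
    ∃ i, v = p.snoc i := by
  have hlt := (lt_iff.1 h).2
  have hδ : v.δ = p.δ + 1 := by
    refine le_antisymm (not_lt.1 fun hv => h' ⟨v.restrict (p.δ + 1) hv.le, ?_, ?_⟩)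
      (Order.add_one_le_iff.2 hlt)
    · exact lt_iff.2 ⟨v.le_restrict _, hv⟩
    · refine lt_iff.2 ⟨le_iff.2 ⟨le_self_add, fun α hα => ?_⟩, Order.lt_add_one_iff.2 le_rfl⟩
      rw [restrict, val_ofFun (hα.trans_le le_self_add), (le_iff.1 h.le).2 α hα]
  refine ⟨v.val p.δ, ext_val hδ fun α hα => ?_⟩
  rw [hδ, Order.lt_add_one_iff] at hα
  rcases hα.lt_or_eq with hα | rfl
  · rw [(le_iff.1 h.le).2 α hα, (le_iff.1 (p.snoc_le _)).2 α hα]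
  · rw [snoc_val]

/-- The conditions weaker than `p` are its restrictions, one for each ordinal up to its length.
Hence closing a countable set upwards keeps it countable. -/
theorem countable_Ici (p : Q L F g) : (Set.Ici p).Countable := by
  have : Countable (Set.Iic p.δ) := by
    have h := (isSuccLimit_omega 1).add_one_lt p.δ_lt
    rw [← ord_aleph, lt_ord, ← succ_aleph0, Order.lt_succ_iff] at h
    rw [← Set.Iio_succ_eq_Iic, Order.succ_eq_add_one, ← Cardinal.mk_le_aleph0_iff,
      Cardinal.mk_Iio_ordinal, Cardinal.lift_le_aleph0]
    exact h
  refine (Set.countable_range fun β : Set.Iic p.δ => p.restrict β β.2).mono ?_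
  intro q hq
  exact ⟨⟨q.δ, (le_iff.1 hq).1⟩, (eq_restrict hq).symm⟩

/-! ### Agreement with a real along a ladder -/

/-- The condition `p` agrees with `x` along the part of the ladder at `η` in its domain. -/
def Agrees (η : Omega) (x : ℕ → Fin 2) (p : Q L F g) : Prop :=
  ∀ i, nthElem (L.C η) i < p.δ → p.val (nthElem (L.C η) i) = x i

/-- Below a length smaller than η the ladder has only finitely many points, so agreement is
membership in a basic clopen set, where `F` takes both values. -/
theorem exists_agrees (hF : IsDenseFn F) (p : Q L F g) (η : Omega) (h : p.δ < η) :
    ∃ x, g η ∈ F x ∧ Agrees η x p := by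
  obtain ⟨n, hn⟩ := L.exists_forall_le_nthElem η h
  have : g η ∈ F.image (cyl fun i : Fin n => p.val (nthElem (L.C η) i)) := by
    rw [hF]; trivial
  obtain ⟨x, hx, hgx⟩ := this
  exact ⟨x, hgx, fun i hi => (hx ⟨i, (hn i).1 hi⟩).symm⟩

theorem Agrees.of_le {η : Omega} {x : ℕ → Fin 2} {p q : Q L F g} (hp : Agrees η x p) (hqp : q ≤ p)
    (h : ∀ i, nthElem (L.C η) i < q.δ → nthElem (L.C η) i < p.δ) : Agrees η x q := fun i hi => by
  rw [(le_iff.1 hqp).2 _ (h i hi), hp i (h i hi)]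

/-- Sets of conditions in which a condition can be prolonged, with prescribed values at finitely
many places, to the length of any other condition in the set. -/
structure Flexible (S : Set (Q L F g)) : Prop where
  snoc_mem : ∀ u ∈ S, ∀ i, u.snoc i ∈ S
  isUpperSet : IsUpperSet S
  exists_le : ∀ u ∈ S, ∀ b ∈ S, u.δ ≤ b.δ → ∃ v ∈ S, v ≤ u ∧ v.δ = b.δ

theorem Flexible.exists_agrees {S : Set (Q L F g)} (hS : Flexible S) {η : Omega}
    {x : ℕ → Fin 2} {b : Q L F g} (hb : b ∈ S) (n : ℕ) (hn : nthElem (L.C η) n < b.δ)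
    {u : Q L F g} (hu : u ∈ S) (hux : Agrees η x u) :
    ∃ v ∈ S, v ≤ u ∧ Agrees η x v ∧ nthElem (L.C η) n < v.δ := by
  have hmono := L.nthElem_strictMono η
  -- One ladder point at a time: stop exactly at the next one and append the value of `x` there.
  have key : ∀ n, nthElem (L.C η) n < b.δ → ∀ w ∈ S, w ≤ u → Agrees η x w →
      (∀ i < n, nthElem (L.C η) i < w.δ) →
      ∃ v ∈ S, v ≤ u ∧ Agrees η x v ∧ nthElem (L.C η) n < v.δ := by
    intro n hn w hw hwu hwx hlt
    by_cases h : nthElem (L.C η) n < w.δ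
    · exact ⟨w, hw, hwu, hwx, h⟩
    obtain ⟨v, hv, hvw, hvδ⟩ := hS.exists_le w hw (b.restrict _ hn.le)
      (hS.isUpperSet (b.le_restrict _) hb) (not_lt.1 h)
    replace hvδ : v.δ = nthElem (L.C η) n := hvδ
    refine ⟨v.snoc (x n), hS.snoc_mem v hv _, (v.snoc_le _).trans (hvw.trans hwu), ?_, ?_⟩
    · intro i hi
      rw [snoc_δ, hvδ, Order.lt_add_one_iff, hmono.le_iff_le] at hi
      rcases hi.lt_or_eq with hi | rfl
      · rw [(le_iff.1 ((v.snoc_le _).trans hvw)).2 _ (hlt i hi), hwx i (hlt i hi)]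
      · rw [← hvδ, snoc_val]
    · rw [snoc_δ, hvδ]; exact Order.lt_add_one_iff.2 le_rfl
  induction n with
  | zero => exact key 0 hn u hu le_rfl hux (by simp)
  | succ n ih =>
    obtain ⟨w, hw, hwu, hwx, hlt⟩ := ih ((hmono n.lt_succ_self).trans hn)
    exact key (n + 1) hn w hw hwu hwx fun i hi =>
      (hmono.monotone (Nat.lt_succ_iff.1 hi)).trans_lt hlt

/-- Amalgamation of a descending sequence of conditions agreeing with a suitable real along the
ladder at the supremum of their lengths. -/
theorem exists_le_of_agrees {η : Omega} {x : ℕ → Fin 2} (hx : g η ∈ F x) {u : ℕ → Q L F g}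
    (hu : Antitone u) (hlt : ∀ n, (u n).δ < η) (hux : ∀ n, Agrees η x (u n))
    (hcof : ∀ i, ∃ n, nthElem (L.C η) i < (u n).δ) : ∃ q : Q L F g, q.δ = η ∧ ∀ n, q ≤ u n := by
  classical
  have hcof' : ∀ α < (η : Ordinal), ∃ n, α < (u n).δ := fun α hα => by
    obtain ⟨i, hi⟩ := L.exists_le_nthElem η hα
    obtain ⟨n, hn⟩ := hcof i
    exact ⟨n, hi.trans_lt hn⟩
  -- The union of the sequence; the default value 0 is used only at ordinals outside every domain,
  -- in particular never below η.
  let f : Ordinal → Fin 2 := fun α => if h : ∃ n, α < (u n).δ then (u (Nat.find h)).val α else 0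
  have hf : ∀ n, ∀ α < (u n).δ, f α = (u n).val α := fun n α hα => by
    have h : ∃ n, α < (u n).δ := ⟨n, hα⟩
    simp only [f, dif_pos h]
    exact ((le_iff.1 (hu (Nat.find_min' h hα))).2 α (Nat.find_spec h)).symm
  refine ⟨ofFun η η.2.2 f fun ζ hζ => ?_, rfl, fun n => le_iff.2 ⟨(hlt n).le, fun α hα => ?_⟩⟩
  · rcases hζ.lt_or_eq with hζ | hζ
    · obtain ⟨n, hn⟩ := hcof' ζ hζ
      convert (u n).coded_val ζ hn.le using 2
      funext i
      exact hf n _ ((L.nthElem_lt ζ i).trans hn)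
    · obtain rfl : ζ = η := Subtype.ext hζ
      convert hx using 2
      funext i
      obtain ⟨n, hn⟩ := hcof i
      rw [hf n _ hn, hux n i hn]
  · rw [val_ofFun (hα.trans (hlt n)), hf n α hα]

/-- Fusion inside a set `Y` of conditions of length less than `η`. -/
theorem exists_le_forall_exists_mem {η : Omega} {x : ℕ → Fin 2} (hx : g η ∈ F x)
    {Y : Set (Q L F g)} (hY : ∀ u ∈ Y, u.δ < η) {E : ℕ → Set (Q L F g)}
    (hE : ∀ n, ∀ u ∈ Y, Agrees η x u → ∃ v ∈ Y, v ≤ u ∧ Agrees η x v ∧ v ∈ E n)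
    (hcof : ∀ i, ∃ n, ∀ u ∈ E n, nthElem (L.C η) i < u.δ)
    {p : Q L F g} (hp : p ∈ Y) (hpx : Agrees η x p) :
    ∃ q ≤ p, q.δ = η ∧ ∀ n, ∃ u ∈ Y, u ∈ E n ∧ q ≤ u := by
  choose! v hvY hvle hvx hvE using hE
  let u : ℕ → Q L F g := fun n => Nat.rec p (fun n w => v n w) n
  have hu : ∀ n, u n ∈ Y ∧ Agrees η x (u n) := fun n => by
    induction n with
    | zero => exact ⟨hp, hpx⟩
    | succ n ih => exact ⟨hvY n _ ih.1 ih.2, hvx n _ ih.1 ih.2⟩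
  have hsucc : ∀ n, u (n + 1) ∈ E n := fun n => hvE n _ (hu n).1 (hu n).2
  obtain ⟨q, hqδ, hq⟩ := exists_le_of_agrees hx (u := u)
    (antitone_nat_of_succ_le fun n => hvle n _ (hu n).1 (hu n).2) (fun n => hY _ (hu n).1)
    (fun n => (hu n).2) fun i => by
      obtain ⟨n, hn⟩ := hcof i
      exact ⟨n + 1, hn _ (hsucc n)⟩
  exact ⟨q, hq 0, hqδ, fun n => ⟨u (n + 1), (hu (n + 1)).1, hsucc n, hq (n + 1)⟩⟩

/-- Conditions can be extended to any countable length. -/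
theorem exists_le_length_eq (hF : IsDenseFn F) (p : Q L F g) {β : Ordinal} (hβ : p.δ ≤ β)
    (hβ' : β < ω₁) : ∃ q ≤ p, q.δ = β := by
  induction β using Ordinal.limitRecOn generalizing p with
  | zero => exact ⟨p, le_rfl, le_antisymm hβ zero_le⟩
  | add_one β ih =>
    rcases hβ.lt_or_eq with hβ | hβ
    · obtain ⟨q, hq, hqδ⟩ := ih p (Order.lt_add_one_iff.1 hβ)
        ((Order.lt_add_one_iff.2 le_rfl).trans hβ')
      exact ⟨q.snoc 0, (q.snoc_le 0).trans hq, by rw [snoc_δ, hqδ]⟩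
    · exact ⟨p, le_rfl, hβ⟩
  | limit β hlim ih =>
    rcases hβ.lt_or_eq with hβ | hβ
    · let η : Omega := ⟨β, hlim, hβ'⟩
      obtain ⟨x, hx, hpx⟩ := exists_agrees hF p η hβ
      -- By the induction hypothesis all conditions shorter than the limit form a flexible set, so
      -- fusion with no dense sets to meet already reaches it.
      have hflex : Flexible {u : Q L F g | u.δ < β} :=
        { snoc_mem := fun u hu i => hlim.add_one_lt hu
          isUpperSet := fun u v huv hu => lt_of_le_of_lt (le_iff.1 huv).1 hu
          exists_le := fun u _ b hb hub => by
            obtain ⟨v, hv, hvδ⟩ := ih b.δ hb u hub b.δ_lt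
            exact ⟨v, hvδ.trans_lt hb, hv, hvδ⟩ }
      obtain ⟨q, hq, hqδ, -⟩ := exists_le_forall_exists_mem (η := η) hx (fun _ hu => hu)
        (E := fun n => {u | nthElem (L.C η) n < u.δ}) (fun n u hu hux => by
          obtain ⟨b, hb, hbδ⟩ := ih _ (hlim.add_one_lt (L.nthElem_lt η n))
            (p.restrict 0 zero_le) zero_le
            ((hlim.add_one_lt (L.nthElem_lt η n)).trans hβ')
          exact hflex.exists_agrees (b := b) (hbδ.trans_lt (hlim.add_one_lt (L.nthElem_lt η n))) n
            (hbδ ▸ Order.lt_add_one_iff.2 le_rfl) hu hux)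
        (fun i => ⟨i, fun _ h => h⟩) (show p.δ < β from hβ) hpx
      exact ⟨q, hq, hqδ⟩
    · exact ⟨p, le_rfl, hβ⟩

end Q

/-! ### Countable closures -/

/-- A countable set can be enlarged to a countable set closed under an operation with countable
values. -/
theorem exists_countable_closed {α : Type*} (op : α → α → Set α) (hop : ∀ a b, (op a b).Countable)
    {T : Set α} (hT : T.Countable) :
    ∃ S : Set α, S.Countable ∧ T ⊆ S ∧ ∀ a ∈ S, ∀ b ∈ S, op a b ⊆ S := by
  let step : Set α → Set α := fun A => A ∪ ⋃ a ∈ A, ⋃ b ∈ A, op a b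
  let A : ℕ → Set α := fun n => step^[n] T
  have hsucc : ∀ n, A (n + 1) = step (A n) := fun n => Function.iterate_succ_apply' step n T
  have hmono : Monotone A := monotone_nat_of_le_succ fun n => by
    rw [hsucc]; exact Set.subset_union_left
  have hcount : ∀ n, (A n).Countable := fun n => by
    induction n with
    | zero => exact hT
    | succ n ih =>
      rw [hsucc]
      exact ih.union (ih.biUnion fun a _ => ih.biUnion fun b _ => hop a b)
  refine ⟨⋃ n, A n, Set.countable_iUnion hcount, Set.subset_iUnion A 0, ?_⟩
  intro a ha b hb
  obtain ⟨m, hm⟩ := Set.mem_iUnion.1 ha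
  obtain ⟨n, hn⟩ := Set.mem_iUnion.1 hb
  have hm' := hmono (le_max_left m n) hm
  have hn' := hmono (le_max_right m n) hn
  refine Set.Subset.trans ?_ (Set.subset_iUnion A (max m n + 1))
  rw [hsucc]
  exact fun x hx => Or.inr (Set.mem_biUnion hm' (Set.mem_biUnion hn' hx))

/-! ### Reservoirs and fusion over a countable set of conditions -/

namespace Q

theorem exists_forall_lt_length (hF : IsDenseFn F) (p : Q L F g) {S : Set (Q L F g)}
    (hS : S.Countable) : ∃ c : Q L F g, ∀ s ∈ S, s.δ < c.δ := by
  have := hS.to_subtype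
  let β : Ordinal := ⨆ s : S, s.1.δ
  have hβ : β + 1 < ω₁ :=
    (isSuccLimit_omega 1).add_one_lt (Ordinal.iSup_lt_omega_one fun s => s.1.δ_lt)
  obtain ⟨c, -, hc⟩ := exists_le_length_eq hF (p.restrict 0 zero_le) zero_le hβ
  refine ⟨c, fun s hs => ?_⟩
  rw [hc, Order.lt_add_one_iff]
  exact Ordinal.le_iSup (fun s : S => s.1.δ) ⟨s, hs⟩

/-- `S` is a flexible set containing `p` and `b` in which `D` is dense, and `c` is longer than all
the members of `S`. -/
structure IsReservoir (D : Set (Q L F g)) (p b : Q L F g) (S : Set (Q L F g)) (c : Q L F g) :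
    Prop where
  flexible : Flexible S
  left_mem : p ∈ S
  right_mem : b ∈ S
  dense : ∀ u ∈ S, ∃ d ∈ S, d ∈ D ∧ d ≤ u
  lt_length : ∀ s ∈ S, s.δ < c.δ

theorem exists_isReservoir (hF : IsDenseFn F) {D : Set (Q L F g)} (hD : DenseIn D)
    (p b : Q L F g) : ∃ S c, S.Countable ∧ IsReservoir D p b S c := by
  choose d hdD hd using hD
  have hext : ∀ u b : Q L F g, ∃ v, u.δ ≤ b.δ → v ≤ u ∧ v.δ = b.δ := fun u b => by
    by_cases h : u.δ ≤ b.δ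
    · obtain ⟨v, hv⟩ := exists_le_length_eq hF u h b.δ_lt
      exact ⟨v, fun _ => hv⟩
    · exact ⟨u, fun h' => absurd h' h⟩
  choose v hv using hext
  -- Close `{p, b}` under chosen extensions into `D`, chosen prolongations, restrictions and
  -- one-step extensions.
  obtain ⟨S, hSc, hpb, hS⟩ := exists_countable_closed
    (fun u b : Q L F g => {d u, v u b} ∪ (Set.Ici u ∪ Set.range u.snoc))
    (fun u b => (Set.to_countable _).union (u.countable_Ici.union (Set.countable_range _)))
    (Set.to_countable {p, b})
  obtain ⟨c, hc⟩ := exists_forall_lt_length hF p hSc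
  refine ⟨S, c, hSc, ⟨⟨fun u hu i => ?_, fun u w huw hu => ?_, fun u hu b hb hub => ?_⟩,
    hpb (by simp), hpb (by simp), fun u hu => ?_, hc⟩⟩
  · exact hS u hu u hu (Or.inr (Or.inr ⟨i, rfl⟩))
  · exact hS u hu u hu (Or.inr (Or.inl huw))
  · exact ⟨v u b, hS u hu b hb (by simp), hv u b hub⟩
  · exact ⟨d u, hS u hu u hu (by simp), hdD u, hd u⟩

/-- If a countable set `Y` of conditions contains enough reservoirs, then below every member of `Y`
there is a condition extending members of `Y` in each of countably many dense sets. -/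
theorem exists_le_of_reservoirs (hF : IsDenseFn F) {Y : Set (Q L F g)} (hY : Y.Countable)
    {D : ℕ → Set (Q L F g)}
    (hres : ∀ n, ∀ p ∈ Y, ∀ b ∈ Y, ∃ S ⊆ Y, ∃ c ∈ Y, IsReservoir (D n) p b S c)
    {p : Q L F g} (hp : p ∈ Y) : ∃ q ≤ p, ∀ n, ∃ d ∈ Y, d ∈ D n ∧ q ≤ d := by
  have := hY.to_subtype
  -- The bound of any reservoir containing `u` is longer than `u`; hence the supremum of lengths is
  -- not attained and is a limit.
  have hYlt : ∀ u ∈ Y, ∃ v ∈ Y, u.δ < v.δ := fun u hu => by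
    obtain ⟨S, -, c, hc, h⟩ := hres 0 u hu u hu
    exact ⟨c, hc, h.lt_length u h.left_mem⟩
  let β : Ordinal := ⨆ u : Y, u.1.δ
  have hβ : β < ω₁ := Ordinal.iSup_lt_omega_one fun u => u.1.δ_lt
  have hlt : ∀ u ∈ Y, u.δ < β := fun u hu => by
    obtain ⟨v, hv, huv⟩ := hYlt u hu
    exact huv.trans_le (Ordinal.le_iSup (fun u : Y => u.1.δ) ⟨v, hv⟩)
  have hex : ∀ α < β, ∃ u ∈ Y, α < u.δ := fun α hα => by
    obtain ⟨u, hu⟩ := Ordinal.lt_iSup_iff.1 hα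
    exact ⟨u, u.2, hu⟩
  have hlim : Order.IsSuccLimit β := by
    rw [Ordinal.isSuccLimit_iff, Order.isSuccPrelimit_iff_succ_lt]
    refine ⟨(zero_le.trans_lt (hlt p hp)).ne', fun α hα => ?_⟩
    obtain ⟨u, hu, hαu⟩ := hex α hα
    exact (Order.succ_le_of_lt hαu).trans_lt (hlt u hu)
  let η : Omega := ⟨β, hlim, hβ⟩
  obtain ⟨x, hx, hpx⟩ := exists_agrees hF p η (hlt p hp)
  let E : ℕ → Set (Q L F g) := fun n => {u | nthElem (L.C η) n < u.δ ∧ ∃ d ∈ Y, d ∈ D n ∧ u ≤ d}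
  obtain ⟨q, hq, -, hqE⟩ := exists_le_forall_exists_mem (η := η) hx hlt (E := E)
    (fun n u hu hux => by
      obtain ⟨b, hb, hbn⟩ := hex _ (L.nthElem_lt η n)
      obtain ⟨S, hSY, c, hc, hS⟩ := hres n u hu b hb
      obtain ⟨w, hw, hwu, hwx, hwn⟩ := hS.flexible.exists_agrees hS.right_mem n hbn hS.left_mem hux
      -- The bound `c` lies in `Y`, so it is shorter than η, and only the first `N` ladder points
      -- can be reached in `S`.
      obtain ⟨N, hN⟩ := L.exists_forall_le_nthElem η (hlt c hc)
      have : ∃ v ∈ S, v ≤ w ∧ Agrees η x v ∧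
          ∀ s ∈ S, ∀ i, nthElem (L.C η) i < s.δ → nthElem (L.C η) i < v.δ := by
        have hmono := (L.nthElem_strictMono η).monotone
        have aux : ∀ m ≤ N, ∃ v ∈ S, v ≤ w ∧ Agrees η x v ∧
          ∀ s ∈ S, ∀ i < m, nthElem (L.C η) i < s.δ → nthElem (L.C η) i < v.δ := by
          intro m
          induction m with
          | zero => exact fun _ => ⟨w, hw, le_rfl, hwx, by simp⟩
          | succ m ih =>
            intro hm
            obtain ⟨v, hv, hvw, hvx, hvs⟩ := ih (Nat.le_of_succ_le hm)
            by_cases h : ∃ s ∈ S, nthElem (L.C η) m < s.δ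
            · obtain ⟨s, hs, hsm⟩ := h
              obtain ⟨v', hv', hvv', hvx', hm'⟩ := hS.flexible.exists_agrees hs m hsm hv hvx
              exact ⟨v', hv', hvv'.trans hvw, hvx', fun s _ i hi _ =>
                (hmono (Nat.lt_succ_iff.1 hi)).trans_lt hm'⟩
            -- No member of `S` reaches the ladder point `m`, so nothing has to be done there.
            · refine ⟨v, hv, hvw, hvx, fun s hs i hi his => ?_⟩
              rcases (Nat.lt_succ_iff.1 hi).lt_or_eq with hi | rfl
              · exact hvs s hs i hi his
              · exact absurd ⟨s, hs, his⟩ h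
        obtain ⟨v, hv, hvw, hvx, hvs⟩ := aux N le_rfl
        exact ⟨v, hv, hvw, hvx, fun s hs i hi =>
          hvs s hs i ((hN i).1 (hi.trans (hS.lt_length s hs))) hi⟩
      obtain ⟨v, hv, hvw, hvx, hvs⟩ := this
      obtain ⟨d, hd, hdD, hdv⟩ := hS.dense v hv
      -- Agreement survives the step into `D n`: every ladder point in the domain of `d` was already
      -- in the domain of `v`.
      exact ⟨d, hSY hd, hdv.trans (hvw.trans hwu), hvx.of_le hdv (hvs d hd),
        hwn.trans_le (le_iff.1 (hdv.trans hvw)).1, d, hSY hd, hdD, le_rfl⟩)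
    (fun i => ⟨i, fun u hu => hu.1⟩) hp hpx
  refine ⟨q, hq, fun n => ?_⟩
  obtain ⟨u, -, ⟨-, d, hdY, hdD, hud⟩, hqu⟩ := hqE n
  exact ⟨d, hdY, hdD, hqu.trans hud⟩

end Q

/-! ### Distributivity and new reals -/

theorem omegaDistributive_Q (hF : IsDenseFn F) : OmegaDistributive (Q L F g) := by
  intro D hD p
  choose S c hSc hS using fun n p b => Q.exists_isReservoir hF (hD n).1 p b
  obtain ⟨Y, hYc, hpY, hY⟩ := exists_countable_closed
    (fun p b : Q L F g => ⋃ n, insert (c n p b) (S n p b))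
    (fun p b => Set.countable_iUnion fun n => (hSc n p b).insert _) (Set.countable_singleton p)
  obtain ⟨q, hq, hqD⟩ := Q.exists_le_of_reservoirs hF hYc (D := D) (fun n p hp b hb =>
    ⟨S n p b, fun s hs => hY p hp b hb (Set.mem_iUnion.2 ⟨n, Or.inr hs⟩), c n p b,
      hY p hp b hb (Set.mem_iUnion.2 ⟨n, Or.inl rfl⟩), hS n p b⟩) (hpY rfl)
  refine ⟨q, Set.mem_iInter.2 fun n => ?_, hq⟩
  obtain ⟨d, -, hd, hqd⟩ := hqD n
  exact (hD n).2 hqd hd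

section

variable {P : Type u} [Preorder P]

theorem ForcesMem.mono {A : ℕ → ℕ → Set P} {q r : P} {n m : ℕ} (h : ForcesMem A q n m)
    (hr : r ≤ q) : ForcesMem A r n m := fun s hs => h s (hs.trans hr)

theorem OmegaDistributive.addsNoNewReals (h : OmegaDistributive P) : AddsNoNewReals P := by
  intro A q hq
  -- Conditions deciding the `n`-th value are dense only below `q`; adding those incompatible with
  -- `q` makes the set dense everywhere.
  obtain ⟨r, hr, hrq⟩ := h (fun n => {r | (∃ m, ForcesMem A r n m) ∨ ¬Compat r q}) (fun n => by
    refine ⟨fun r => ?_, fun r s hsr hr => ?_⟩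
    · by_cases hc : Compat r q
      · obtain ⟨s, hsr, hsq⟩ := hc
        obtain ⟨d, hd, hds⟩ := (hq n).1 s hsq
        exact ⟨d, Or.inl hd, hds.trans hsr⟩
      · exact ⟨r, Or.inr hc, le_rfl⟩
    · rcases hr with ⟨m, hm⟩ | hr
      · exact Or.inl ⟨m, hm.mono hsr⟩
      · exact Or.inr fun ⟨t, ht, htq⟩ => hr ⟨t, ht.trans hsr, htq⟩) q
  have : ∀ n, ∃ m, ForcesMem A r n m := fun n =>
    (Set.mem_iInter.1 hr n).resolve_right fun hc => hc ⟨r, le_rfl, hrq⟩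
  choose y hy using this
  exact ⟨r, hrq, y, hy⟩

end

/-! ### Closure properties of `H(θ)` -/

section Hereditary

variable {θ : Cardinal.{u}}

theorem mem_H_of_mem {x y : ZFSet.{u}} (hy : y ∈ H θ) (h : x ∈ y) : x ∈ H θ := by
  obtain ⟨t, ht, hyt, hcard⟩ := hy
  exact ⟨t, ht, ht.subset_of_mem (hyt h), hcard⟩

theorem mem_H_of_subset {x y : ZFSet.{u}} (hy : y ∈ H θ) (h : x ⊆ y) : x ∈ H θ := by
  obtain ⟨t, ht, hyt, hcard⟩ := hy
  exact ⟨t, ht, h.trans hyt, hcard⟩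

/-- The range together with the union of transitive witnesses for its members is transitive, and
regularity keeps its size below θ. -/
theorem range_mem_H (hθ : θ.IsRegular) {ι : Type u} (hι : #ι < θ) {f : ι → ZFSet.{u}}
    (hf : ∀ i, f i ∈ H θ) : ZFSet.range f ∈ H θ := by
  choose t ht hft hcard using hf
  refine ⟨ZFSet.range f ∪ ZFSet.iUnion t, ?_, ?_, ?_⟩
  · intro y hy z hz
    rw [ZFSet.mem_union] at hy ⊢
    refine Or.inr ?_
    rcases hy with hy | hy
    · obtain ⟨i, rfl⟩ := ZFSet.mem_range.1 hy
      exact ZFSet.mem_iUnion.2 ⟨i, hft i hz⟩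
    · exact (ZFSet.IsTransitive.iUnion ht).mem_trans hz hy
  · exact fun y hy => ZFSet.mem_union.2 (Or.inl hy)
  · refine ZFSet.card_union_le.trans_lt (add_lt_of_lt hθ.aleph0_le ?_ ?_)
    · have := ZFSet.lift_card_range_le (f := f)
      rw [Cardinal.lift_id, Cardinal.lift_id] at this
      exact this.trans_lt hι
    · have := ZFSet.lift_card_iUnion_le_sum_card (f := t)
      rw [Cardinal.lift_id] at this
      exact this.trans_lt (sum_lt_of_isRegular hθ hι hcard)

theorem pair_mem_H (hθ : θ.IsRegular) {x y : ZFSet.{u}} (hx : x ∈ H θ) (hy : y ∈ H θ) :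
    ({x, y} : ZFSet) ∈ H θ := by
  have h := range_mem_H hθ (ι := ULift Bool) (f := fun b => if b.down then x else y)
    ((lt_aleph0_of_finite _).trans_le hθ.aleph0_le) (by rintro ⟨_ | _⟩ <;> simpa)
  convert h
  ext z
  rw [ZFSet.mem_pair, ZFSet.mem_range]
  constructor
  · rintro (rfl | rfl)
    exacts [⟨⟨true⟩, rfl⟩, ⟨⟨false⟩, rfl⟩]
  · rintro ⟨⟨_ | _⟩, rfl⟩
    exacts [Or.inr rfl, Or.inl rfl]

theorem kpair_mem_H (hθ : θ.IsRegular) {x y : ZFSet.{u}} (hx : x ∈ H θ) (hy : y ∈ H θ) :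
    ZFSet.pair x y ∈ H θ := by
  refine pair_mem_H hθ ?_ (pair_mem_H hθ hx hy)
  have := pair_mem_H hθ hx hx
  rwa [ZFSet.pair_eq_singleton] at this

end Hereditary

/-! ### Definability over a forcing notion in `H(θ)` -/

section Definability

variable {θ : Cardinal.{u}} (X : langSet.ElementarySubstructure (H θ)) {P : Type u} (em : P → H θ)
  {α β : Type}

/-- Terms with variables for conditions, variables for sets, and parameters from `X`. -/
def IsTm (t : (α → P) → (β → H θ) → H θ) : Prop :=
  ∃ s : (α ⊕ β) ⊕ X, ∀ v w, t v w = Sum.elim (Sum.elim (em ∘ v) w) Subtype.val s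

/-- Predicates of conditions and sets that are definable in `H(θ)` with parameters from `X`. -/
def IsDfn (φ : (α → P) → (β → H θ) → Prop) : Prop :=
  ∃ ψ : langSet.Formula ((α ⊕ β) ⊕ X),
    ∀ v w, ψ.Realize (Sum.elim (Sum.elim (em ∘ v) w) Subtype.val) ↔ φ v w

variable {X em}

theorem IsTm.varP (i : α) : IsTm X em fun v (_ : β → H θ) => em (v i) :=
  ⟨.inl (.inl i), fun _ _ => rfl⟩

theorem IsTm.varS (j : β) : IsTm X em fun (_ : α → P) w => w j :=
  ⟨.inl (.inr j), fun _ _ => rfl⟩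

theorem IsTm.const {x : H θ} (hx : x ∈ X) : IsTm X em fun (_ : α → P) (_ : β → H θ) => x :=
  ⟨.inr ⟨x, hx⟩, fun _ _ => rfl⟩

theorem IsTm.weaken {t : (α → P) → (β → H θ) → H θ} (h : IsTm X em t) :
    IsTm X em fun v (w : Option β → H θ) => t v fun j => w (some j) := by
  obtain ⟨(i | j) | x, ht⟩ := h
  exacts [⟨.inl (.inl i), fun v w => ht v _⟩, ⟨.inl (.inr (some j)), fun v w => ht v _⟩,
    ⟨.inr x, fun v w => ht v _⟩]

namespace IsDfn

variable {φ φ' : (α → P) → (β → H θ) → Prop}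

theorem mem {s t : (α → P) → (β → H θ) → H θ} (hs : IsTm X em s) (ht : IsTm X em t) :
    IsDfn X em fun v w => (s v w : ZFSet) ∈ (t v w : ZFSet) := by
  obtain ⟨s', hs⟩ := hs
  obtain ⟨t', ht⟩ := ht
  let R : langSet.Relations 2 := SetRel.mem
  refine ⟨R.formula₂ (Language.Term.var s') (Language.Term.var t'), fun v w => ?_⟩
  beta_reduce
  rw [Language.Formula.realize_rel₂, hs, ht]
  rfl

theorem eq {s t : (α → P) → (β → H θ) → H θ} (hs : IsTm X em s) (ht : IsTm X em t) :
    IsDfn X em fun v w => s v w = t v w := by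
  obtain ⟨s', hs⟩ := hs
  obtain ⟨t', ht⟩ := ht
  refine ⟨(Language.Term.var s').equal (Language.Term.var t'), fun v w => ?_⟩
  beta_reduce
  rw [Language.Formula.realize_equal, hs, ht]
  rfl

theorem not (h : IsDfn X em φ) : IsDfn X em fun v w => ¬φ v w := by
  obtain ⟨ψ, hψ⟩ := h
  exact ⟨∼ψ, fun v w => by rw [Language.Formula.realize_not, hψ]⟩

theorem and (h : IsDfn X em φ) (h' : IsDfn X em φ') : IsDfn X em fun v w => φ v w ∧ φ' v w := by
  obtain ⟨ψ, hψ⟩ := h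
  obtain ⟨ψ', hψ'⟩ := h'
  exact ⟨ψ ⊓ ψ', fun v w => by rw [Language.Formula.realize_inf, hψ, hψ']⟩

theorem imp (h : IsDfn X em φ) (h' : IsDfn X em φ') : IsDfn X em fun v w => φ v w → φ' v w := by
  obtain ⟨ψ, hψ⟩ := h
  obtain ⟨ψ', hψ'⟩ := h'
  exact ⟨ψ.imp ψ', fun v w => by rw [Language.Formula.realize_imp, hψ, hψ']⟩

theorem congr (h : IsDfn X em φ) (h' : ∀ v w, φ' v w ↔ φ v w) : IsDfn X em φ' := by
  obtain rfl : φ' = φ := funext fun v => funext fun w => propext (h' v w)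
  exact h

theorem or (h : IsDfn X em φ) (h' : IsDfn X em φ') : IsDfn X em fun v w => φ v w ∨ φ' v w :=
  (h.not.imp h').congr fun _ _ => or_iff_not_imp_left

theorem iff (h : IsDfn X em φ) (h' : IsDfn X em φ') : IsDfn X em fun v w => φ v w ↔ φ' v w :=
  ((h.imp h').and (h'.imp h)).congr fun _ _ => iff_iff_implies_and_implies

theorem exS {χ : (α → P) → (β → H θ) → H θ → Prop}
    (h : IsDfn X em fun v (w : Option β → H θ) => χ v (fun j => w (some j)) (w none)) :
    IsDfn X em fun v w => ∃ y, χ v w y := by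
  obtain ⟨ψ, hψ⟩ := h
  let ρ : (α ⊕ Option β) ⊕ X → ((α ⊕ β) ⊕ X) ⊕ Unit := Sum.elim
    (Sum.elim (fun i => .inl (.inl (.inl i))) fun j => j.elim (.inr ()) fun j =>
      .inl (.inl (.inr j))) fun x => .inl (.inr x)
  refine ⟨(ψ.relabel ρ).iExs Unit, fun v w => ?_⟩
  have key : ∀ y : H θ, Sum.elim (Sum.elim (Sum.elim (em ∘ v) w) Subtype.val) (fun _ => y) ∘ ρ =
      Sum.elim (Sum.elim (em ∘ v) fun j : Option β => j.elim y w)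
        (Subtype.val : X → H θ) := by
    intro y
    funext s
    rcases s with (i | _ | j) | x <;> rfl
  rw [Language.Formula.realize_iExs]
  simp_rw [Language.Formula.realize_relabel]
  constructor
  · rintro ⟨y, hy⟩
    exact ⟨y (), (hψ v fun j => j.elim (y ()) w).1 (key (y ()) ▸ hy)⟩
  · rintro ⟨y, hy⟩
    exact ⟨fun _ => y, (key y).symm ▸ (hψ v fun j => j.elim y w).2 hy⟩

theorem allS {χ : (α → P) → (β → H θ) → H θ → Prop}
    (h : IsDfn X em fun v (w : Option β → H θ) => χ v (fun j => w (some j)) (w none)) :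
    IsDfn X em fun v w => ∀ y, χ v w y :=
  (exS (χ := fun v w y => ¬χ v w y) h.not).not.congr fun _ _ => by simp

/-- A quantifier over conditions is a set quantifier bounded by the code `c` of the forcing; `ρ`
moves the bound variable from the condition slots to the set slots. -/
theorem exP {c : H θ} (hc : c ∈ X) (hce : ∀ y : H θ, (y : ZFSet) ∈ (c : ZFSet) ↔ ∃ p, em p = y)
    {χ : (α → P) → (β → H θ) → P → Prop}
    (h : IsDfn X em fun (v : Option α → P) w => χ (fun i => v (some i)) w (v none)) :
    IsDfn X em fun v w => ∃ p, χ v w p := by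
  obtain ⟨ψ, hψ⟩ := h
  let ρ : (Option α ⊕ β) ⊕ X → (α ⊕ Option β) ⊕ X := Sum.elim
    (Sum.elim (fun i => i.elim (.inl (.inr none)) fun i => .inl (.inl i))
      fun j => .inl (.inr (some j))) .inr
  have hρ : ∀ v w y, Sum.elim (Sum.elim (em ∘ v) fun j : Option β => j.elim y w)
      (Subtype.val : X → H θ) ∘ ρ = Sum.elim (Sum.elim (fun i : Option α => i.elim y (em ∘ v)) w)
        (Subtype.val : X → H θ) := by
    intro v w y
    funext s
    rcases s with ((_ | i) | j) | x <;> rfl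
  have h' : IsDfn X em fun v (w : Option β → H θ) => (w none : ZFSet) ∈ (c : ZFSet) ∧
      (ψ.relabel ρ).Realize (Sum.elim (Sum.elim (em ∘ v) w) Subtype.val) :=
    (mem (.varS _) (.const hc)).and ⟨ψ.relabel ρ, fun _ _ => Iff.rfl⟩
  refine (exS (χ := fun v w y => (y : ZFSet) ∈ (c : ZFSet) ∧ (ψ.relabel ρ).Realize
    (Sum.elim (Sum.elim (em ∘ v) fun j : Option β => j.elim y w) Subtype.val)) ?_).congr ?_
  · refine h'.congr fun v w => ?_
    have : (fun j : Option β => j.elim (w none) fun j => w (some j)) = w := by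
      funext j; cases j <;> rfl
    rw [this]
  · intro v w
    have key : ∀ p, χ v w p ↔ (ψ.relabel ρ).Realize
        (Sum.elim (Sum.elim (em ∘ v) fun j : Option β => j.elim (em p) w)
          (Subtype.val : X → H θ)) := fun p => by
      rw [Language.Formula.realize_relabel, hρ]
      refine (hψ (fun i => i.elim p v) w).symm.trans ?_
      have : em ∘ (fun i : Option α => i.elim p v) = fun i => i.elim (em p) (em ∘ v) := by
        funext i; cases i <;> rfl
      rw [this]
    constructor
    · rintro ⟨p, hp⟩
      exact ⟨em p, (hce _).2 ⟨p, rfl⟩, (key p).1 hp⟩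
    · rintro ⟨y, hy, h⟩
      obtain ⟨p, rfl⟩ := (hce y).1 hy
      exact ⟨p, (key p).2 h⟩

theorem allP {c : H θ} (hc : c ∈ X) (hce : ∀ y : H θ, (y : ZFSet) ∈ (c : ZFSet) ↔ ∃ p, em p = y)
    {χ : (α → P) → (β → H θ) → P → Prop}
    (h : IsDfn X em fun (v : Option α → P) w => χ (fun i => v (some i)) w (v none)) :
    IsDfn X em fun v w => ∀ p, χ v w p :=
  (exP hc hce (χ := fun v w p => ¬χ v w p) h.not).not.congr fun _ _ => by simp

theorem relabel {α' β' : Type} (h : IsDfn X em φ) (f : α → α') (k : β → β') :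
    IsDfn X em fun v w => φ (fun i => v (f i)) fun j => w (k j) := by
  obtain ⟨ψ, hψ⟩ := h
  refine ⟨ψ.relabel (Sum.map (Sum.map f k) id), fun v w => ?_⟩
  beta_reduce
  rw [Language.Formula.realize_relabel, ← hψ]
  congr! 1
  funext s
  rcases s with (i | j) | x <;> rfl

theorem pair_mem (hθ : θ.IsRegular) {r s t : (α → P) → (β → H θ) → H θ} (hr : IsTm X em r)
    (hs : IsTm X em s) (ht : IsTm X em t) :
    IsDfn X em fun v w => ZFSet.pair (r v w) (s v w) ∈ (t v w : ZFSet) := by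
  -- The Kuratowski pair `z = {a, b}` with `a = {r}` and `b = {r, s}`. Quantifying over `H θ`
  -- determines these sets because `H θ` is transitive.
  have key : IsDfn X em fun v w => ∃ z a b : H θ, (z : ZFSet) ∈ (t v w : ZFSet) ∧
      (∀ y : H θ, (y : ZFSet) ∈ (a : ZFSet) ↔ y = r v w) ∧
      (∀ y : H θ, (y : ZFSet) ∈ (b : ZFSet) ↔ y = r v w ∨ y = s v w) ∧
      ∀ y : H θ, (y : ZFSet) ∈ (z : ZFSet) ↔ y = a ∨ y = b :=
    exS <| exS <| exS <| (mem (.varS _) ht.weaken.weaken.weaken).and <|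
      (allS <| (mem (.varS _) (.varS _)).iff
        (eq (.varS _) hr.weaken.weaken.weaken.weaken)).and <|
      (allS <| (mem (.varS _) (.varS _)).iff <|
        (eq (.varS _) hr.weaken.weaken.weaken.weaken).or
          (eq (.varS _) hs.weaken.weaken.weaken.weaken)).and <|
      allS <| (mem (.varS _) (.varS _)).iff <| (eq (.varS _) (.varS _)).or (eq (.varS _) (.varS _))
  refine key.congr fun v w => ?_
  have hsing : ({(r v w : ZFSet)} : ZFSet) ∈ H θ := by
    have := pair_mem_H hθ (r v w).2 (r v w).2
    rwa [ZFSet.pair_eq_singleton] at this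
  constructor
  · intro h
    refine ⟨⟨_, kpair_mem_H hθ (r v w).2 (s v w).2⟩, ⟨_, hsing⟩,
      ⟨_, pair_mem_H hθ (r v w).2 (s v w).2⟩, h, ?_, ?_, ?_⟩
    · simp [Subtype.ext_iff]
    · simp [Subtype.ext_iff]
    · simp [Subtype.ext_iff, ZFSet.pair]
  · rintro ⟨z, a, b, hz, ha, hb, hzab⟩
    have ha' : (a : ZFSet) = {(r v w : ZFSet)} := by
      ext y
      refine ⟨fun hy => ?_, fun hy => ?_⟩
      · have := (ha ⟨y, mem_H_of_mem a.2 hy⟩).1 hy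
        simp [← this]
      · rw [ZFSet.mem_singleton] at hy
        exact hy ▸ (ha (r v w)).2 rfl
    have hb' : (b : ZFSet) = {(r v w : ZFSet), (s v w : ZFSet)} := by
      ext y
      rw [ZFSet.mem_pair]
      refine ⟨fun hy => ?_, ?_⟩
      · exact ((hb ⟨y, mem_H_of_mem b.2 hy⟩).1 hy).imp (congrArg Subtype.val) (congrArg Subtype.val)
      · rintro (rfl | rfl)
        exacts [(hb (r v w)).2 (Or.inl rfl), (hb (s v w)).2 (Or.inr rfl)]
    have hz' : (z : ZFSet) = ZFSet.pair (r v w) (s v w) := by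
      rw [ZFSet.pair, ← ha', ← hb']
      ext y
      rw [ZFSet.mem_pair]
      refine ⟨fun hy => ?_, ?_⟩
      · exact ((hzab ⟨y, mem_H_of_mem z.2 hy⟩).1 hy).imp (congrArg Subtype.val)
          (congrArg Subtype.val)
      · rintro (rfl | rfl)
        exacts [(hzab a).2 (Or.inl rfl), (hzab b).2 (Or.inr rfl)]
    rwa [← hz']

/-- The Tarski–Vaught property for sets. -/
theorem exists_mem_set {χ : H θ → Prop}
    (h : IsDfn X em fun (_ : Empty → P) (w : Unit → H θ) => χ (w ())) (hex : ∃ y, χ y) :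
    ∃ y ∈ X, χ y := by
  obtain ⟨ψ, hψ⟩ := h
  let ρ : (Empty ⊕ Unit) ⊕ X → X ⊕ Unit :=
    Sum.elim (Sum.elim Empty.elim Sum.inr) Sum.inl
  have key : ∀ y : H θ, (ψ.relabel ρ).Realize (Sum.elim (Subtype.val : X → H θ) fun _ => y) ↔
      χ y := fun y => by
    rw [Language.Formula.realize_relabel]
    refine Iff.trans ?_ (hψ Empty.elim fun _ => y)
    congr! 1
    funext s
    rcases s with (i | j) | x
    · exact i.elim
    · rfl
    · rfl
  have h₁ : ((ψ.relabel ρ).iExs Unit).Realize (X.subtype ∘ (id : X → X)) := by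
    obtain ⟨y, hy⟩ := hex
    rw [Language.Formula.realize_iExs]
    exact ⟨fun _ => y, (key y).2 hy⟩
  rw [X.subtype.map_formula, Language.Formula.realize_iExs] at h₁
  obtain ⟨y, hy⟩ := h₁
  rw [← X.subtype.map_formula] at hy
  refine ⟨y (), (y ()).2, (key _).1 ?_⟩
  convert hy using 1
  funext s
  rcases s with x | _ <;> rfl

/-- The Tarski–Vaught property for conditions. -/
theorem exists_mem_cond {c : H θ} (hc : c ∈ X)
    (hce : ∀ y : H θ, (y : ZFSet) ∈ (c : ZFSet) ↔ ∃ p, em p = y) {χ : P → Prop}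
    (h : IsDfn X em fun (v : Unit → P) (_ : Empty → H θ) => χ (v ())) (hex : ∃ p, χ p) :
    ∃ p, em p ∈ X ∧ χ p := by
  have h' : IsDfn X em fun (_ : Empty → P) (w : Unit → H θ) => ∃ p, em p = w () ∧ χ p :=
    exP hc hce <| (eq (.varP _) (.varS _)).and
      (h.relabel (α' := Option Empty) (fun _ => none) (Empty.elim : Empty → Unit))
  obtain ⟨p, hp⟩ := hex
  obtain ⟨_, hy, q, rfl, hq⟩ := exists_mem_set (χ := fun y => ∃ p, em p = y ∧ χ p) h'
    ⟨em p, p, rfl, hp⟩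
  exact ⟨q, hy, hq⟩

end IsDfn

end Definability

/-! ### Relations on a forcing notion as members of `H(θ)` -/

section Coding

variable {P : Type u} (e : P ↪ ZFSet.{u})

/-- A binary relation on `P` as a set of ordered pairs of the copy of `P` given by `e`. -/
noncomputable def relSet (R : P → P → Prop) : ZFSet.{u} :=
  ZFSet.range fun z : {z : P × P // R z.1 z.2} => ZFSet.pair (e z.1.1) (e z.1.2)

theorem pair_mem_relSet {R : P → P → Prop} {a b : P} :
    ZFSet.pair (e a) (e b) ∈ relSet e R ↔ R a b := by
  rw [relSet, ZFSet.mem_range]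
  constructor
  · rintro ⟨⟨⟨a', b'⟩, h⟩, hz⟩
    obtain ⟨ha, hb⟩ := ZFSet.pair_injective hz
    rwa [← e.injective ha, ← e.injective hb]
  · exact fun h => ⟨⟨⟨a, b⟩, h⟩, rfl⟩

/-- A set of conditions as a subset of the copy of `P` given by `e`. -/
noncomputable def subsetSet (S : Set P) : ZFSet.{u} := ZFSet.range fun s : S => e s

theorem mem_subsetSet {S : Set P} {a : P} : e a ∈ subsetSet e S ↔ a ∈ S := by
  rw [subsetSet, ZFSet.mem_range]
  exact ⟨fun ⟨s, hs⟩ => e.injective hs ▸ s.2, fun h => ⟨⟨a, h⟩, rfl⟩⟩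

variable {e} {θ : Cardinal.{u}}

theorem subsetSet_mem_H (he : carrierSet e ∈ H θ) (S : Set P) : subsetSet e S ∈ H θ :=
  mem_H_of_subset he fun z hz => by
    obtain ⟨s, rfl⟩ := ZFSet.mem_range.1 hz
    exact ZFSet.mem_range_self _

/-- The embedding of `P` into `H(θ)`. -/
def toH (he : carrierSet e ∈ H θ) (p : P) : H θ :=
  ⟨e p, mem_H_of_mem he (ZFSet.mem_range_self p)⟩

theorem mem_carrierSet_iff (he : carrierSet e ∈ H θ) (y : H θ) :
    (y : ZFSet) ∈ carrierSet e ↔ ∃ p, toH he p = y := by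
  simp only [carrierSet, ZFSet.mem_range, Subtype.ext_iff, toH]

theorem relSet_mem_H (hθ : θ.IsRegular) (hP : #P < θ) (he : carrierSet e ∈ H θ)
    (R : P → P → Prop) : relSet e R ∈ H θ := by
  refine range_mem_H hθ ?_ fun z => kpair_mem_H hθ (toH he _).2 (toH he _).2
  refine (mk_subtype_le _).trans_lt ?_
  rw [mk_prod, Cardinal.lift_id]
  exact mul_lt_of_lt hθ.aleph0_le hP hP

variable [Preorder P] {X : langSet.ElementarySubstructure (H θ)} {he : carrierSet e ∈ H θ}
  {α β : Type} {s t : (α → P) → (β → H θ) → P}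

theorem IsDfn.le (hθ : θ.IsRegular) {l : H θ} (hl : l ∈ X) (hle : (l : ZFSet) = leSet e)
    (hs : IsTm X (toH he) fun v w => toH he (s v w))
    (ht : IsTm X (toH he) fun v w => toH he (t v w)) :
    IsDfn X (toH he) fun v w => s v w ≤ t v w :=
  (IsDfn.pair_mem hθ hs ht (.const hl)).congr fun v w => by
    rw [hle]
    exact (pair_mem_relSet e (R := (· ≤ ·))).symm

theorem IsDfn.lt (hθ : θ.IsRegular) {l : H θ} (hl : l ∈ X) (hle : (l : ZFSet) = leSet e)
    (hs : IsTm X (toH he) fun v w => toH he (s v w))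
    (ht : IsTm X (toH he) fun v w => toH he (t v w)) :
    IsDfn X (toH he) fun v w => s v w < t v w :=
  ((IsDfn.le hθ hl hle hs ht).and (IsDfn.le hθ hl hle ht hs).not).congr fun _ _ =>
    lt_iff_le_not_ge

end Coding

/-! ### Properness -/

namespace Q

/-- The lengths of the proper restrictions of a condition are exactly the ordinals below its own
length, so this is extensionality of ordinals read off the order of the forcing. -/
theorem bisimulation_length_eq (a b : Q L F g) : a.δ = b.δ ↔
    (∀ a', a < a' → ∃ b', b < b' ∧ a'.δ = b'.δ) ∧ ∀ b', b < b' → ∃ a', a < a' ∧ a'.δ = b'.δ := by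
  have below : ∀ (a : Q L F g) {γ}, γ < a.δ → ∃ a', a < a' ∧ a'.δ = γ := fun a γ h =>
    ⟨a.restrict γ h.le, lt_iff.2 ⟨a.le_restrict _, h⟩, rfl⟩
  constructor
  · intro hab
    refine ⟨fun a' ha' => ?_, fun b' hb' => below a (hab ▸ (lt_iff.1 hb').2)⟩
    obtain ⟨b', hb', hδ⟩ := below b (hab ▸ (lt_iff.1 ha').2)
    exact ⟨b', hb', hδ.symm⟩
  · rintro ⟨h₁, h₂⟩
    refine le_antisymm (not_lt.1 fun h => ?_) (not_lt.1 fun h => ?_)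
    · obtain ⟨a', ha', hδ⟩ := below a h
      obtain ⟨b', hb', hab⟩ := h₁ a' ha'
      exact (lt_iff.1 hb').2.ne (hab.symm.trans hδ)
    · obtain ⟨b', hb', hδ⟩ := below b h
      obtain ⟨a', ha', hab⟩ := h₂ b' hb'
      exact (lt_iff.1 ha').2.ne (hab.trans hδ)

/-- Having the same length is the only relation with the property of `bisimulation_length_eq`. -/
theorem length_eq_iff_of_bisimulation {R : Q L F g → Q L F g → Prop}
    (hR : ∀ a b, R a b ↔ (∀ a', a < a' → ∃ b', b < b' ∧ R a' b') ∧
      ∀ b', b < b' → ∃ a', a < a' ∧ R a' b') (a b : Q L F g) : R a b ↔ a.δ = b.δ := by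
  induction h : a.δ using WellFoundedLT.induction generalizing a b with
  | ind γ ih =>
    subst h
    replace ih : ∀ a' b', a < a' → (R a' b' ↔ a'.δ = b'.δ) := fun a' b' ha' =>
      ih _ (lt_iff.1 ha').2 a' b' rfl
    rw [hR, bisimulation_length_eq]
    exact and_congr
      (forall₂_congr fun a' ha' => exists_congr fun b' => and_congr_right fun _ => ih a' b' ha')
      (forall₂_congr fun b' _ => exists_congr fun a' => and_congr_right fun ha' => ih a' b' ha')

/-- One-step extensions leave no minimal element. Infinitude lets a countable reservoir be
enumerated bijectively, so that the successor step of the enumeration is a function. -/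
theorem Flexible.infinite {S : Set (Q L F g)} (hS : Flexible S) (hne : S.Nonempty) :
    S.Infinite := fun hfin => by
  obtain ⟨m, hm⟩ := hfin.exists_minimal hne
  exact absurd (m.snoc_lt 0) (hm.not_lt (hS.snoc_mem m hm.prop 0))

variable {e : Q L F g ↪ ZFSet.{1}} {θ : Cardinal.{1}} {X : langSet.ElementarySubstructure (H θ)}

/-- An elementary substructure contains a code for the relation of having the same length. -/
theorem exists_mem_sameLength (hθ : θ.IsRegular) (hP : #(Q L F g) < θ) (he : carrierSet e ∈ H θ)
    (hcX : (⟨carrierSet e, he⟩ : H θ) ∈ X) {l : H θ} (hl : l ∈ X) (hle : (l : ZFSet) = leSet e) :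
    ∃ r ∈ X, ∀ a b, ZFSet.pair (toH he a) (toH he b) ∈ (r : ZFSet) ↔ a.δ = b.δ := by
  have hce := mem_carrierSet_iff he
  obtain ⟨r, hr, h⟩ := IsDfn.exists_mem_set (X := X) (em := toH he)
    (χ := fun r => ∀ a b, ZFSet.pair (toH he a) (toH he b) ∈ (r : ZFSet) ↔
      (∀ a', a < a' → ∃ b', b < b' ∧ ZFSet.pair (toH he a') (toH he b') ∈ (r : ZFSet)) ∧
      ∀ b', b < b' → ∃ a', a < a' ∧ ZFSet.pair (toH he a') (toH he b') ∈ (r : ZFSet))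
    -- Definability is checked by recursion on the shape of the statement.
    (by
      repeat' first
        | exact IsDfn.lt hθ hl hle (.varP _) (.varP _)
        | exact IsDfn.pair_mem hθ (.varP _) (.varP _) (.varS _)
        | apply IsDfn.and
        | apply IsDfn.iff
        | apply IsDfn.imp
        | apply IsDfn.allP hcX hce
        | apply IsDfn.exP hcX hce)
    ⟨⟨_, relSet_mem_H hθ hP he fun a b => a.δ = b.δ⟩, fun a b => by
      simp only [toH, pair_mem_relSet]
      exact bisimulation_length_eq a b⟩
  exact ⟨r, hr, length_eq_iff_of_bisimulation
    (R := fun a b => ZFSet.pair (toH he a) (toH he b) ∈ (r : ZFSet)) h⟩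

/-- An elementary substructure contains reservoirs for its dense sets. -/
theorem exists_isReservoir_subset (hF : IsDenseFn F) (hθ : θ.IsRegular) (hP : #(Q L F g) < θ)
    (he : carrierSet e ∈ H θ)
    (hcX : (⟨carrierSet e, he⟩ : H θ) ∈ X) {l : H θ} (hl : l ∈ X) (hle : (l : ZFSet) = leSet e)
    {D : H θ} (hD : D ∈ X) (hDd : DenseIn {p | e p ∈ (D : ZFSet)}) {p b : Q L F g}
    (hp : toH he p ∈ X) (hb : toH he b ∈ X) :
    ∃ S ⊆ {p | toH he p ∈ X}, ∃ c, toH he c ∈ X ∧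
      IsReservoir {p | e p ∈ (D : ZFSet)} p b S c := by
  have hce := mem_carrierSet_iff he
  obtain ⟨r, hr, hrel⟩ := exists_mem_sameLength hθ hP he hcX hl hle
  -- The reservoir clauses in terms of `≤` and the same-length relation `r`; a comparison of lengths
  -- says that some weaker condition has the given length. The final clause says that `S` lies in
  -- the orbit of some `u` under a partial function `f`, replacing countability without mentioning
  -- ω.
  obtain ⟨S, hS, hsucc, hup, hext, hpS, hbS, hdense, hbound, hgen⟩ :=
    IsDfn.exists_mem_set (X := X) (em := toH he)
    (χ := fun S =>
      (∀ u, (toH he u : ZFSet) ∈ (S : ZFSet) → ∀ v, v < u → (¬∃ w, v < w ∧ w < u) →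
        (toH he v : ZFSet) ∈ (S : ZFSet)) ∧
      (∀ u v, u ≤ v → (toH he u : ZFSet) ∈ (S : ZFSet) → (toH he v : ZFSet) ∈ (S : ZFSet)) ∧
      (∀ u, (toH he u : ZFSet) ∈ (S : ZFSet) → ∀ b, (toH he b : ZFSet) ∈ (S : ZFSet) →
        (∃ b', b ≤ b' ∧ ZFSet.pair (toH he b') (toH he u) ∈ (r : ZFSet)) →
        ∃ v, (toH he v : ZFSet) ∈ (S : ZFSet) ∧ v ≤ u ∧
          ZFSet.pair (toH he v) (toH he b) ∈ (r : ZFSet)) ∧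
      (toH he p : ZFSet) ∈ (S : ZFSet) ∧
      (toH he b : ZFSet) ∈ (S : ZFSet) ∧
      (∀ u, (toH he u : ZFSet) ∈ (S : ZFSet) → ∃ d, (toH he d : ZFSet) ∈ (S : ZFSet) ∧
        (toH he d : ZFSet) ∈ (D : ZFSet) ∧ d ≤ u) ∧
      (∃ c, ∀ s, (toH he s : ZFSet) ∈ (S : ZFSet) →
        ∃ c', c < c' ∧ ZFSet.pair (toH he s) (toH he c') ∈ (r : ZFSet)) ∧
      ∃ f : H θ, (∀ a b b', ZFSet.pair (toH he a) (toH he b) ∈ (f : ZFSet) →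
          ZFSet.pair (toH he a) (toH he b') ∈ (f : ZFSet) → toH he b = toH he b') ∧
        ∃ u, ∀ Z : H θ, (toH he u : ZFSet) ∈ (Z : ZFSet) →
          (∀ a b, (toH he a : ZFSet) ∈ (Z : ZFSet) →
            ZFSet.pair (toH he a) (toH he b) ∈ (f : ZFSet) → (toH he b : ZFSet) ∈ (Z : ZFSet)) →
          ∀ s, (toH he s : ZFSet) ∈ (S : ZFSet) → (toH he s : ZFSet) ∈ (Z : ZFSet))
    (by
      repeat' first
        | exact IsDfn.lt hθ hl hle (.varP _) (.varP _)
        | exact IsDfn.le hθ hl hle (.varP _) (.varP _)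
        | exact IsDfn.pair_mem hθ (.varP _) (.varP _) (.const hr)
        | exact IsDfn.pair_mem hθ (.varP _) (.varP _) (.varS _)
        | exact IsDfn.mem (.varP _) (.varS _)
        | exact IsDfn.mem (.varP _) (.const hD)
        | exact IsDfn.mem (.const hp) (.varS _)
        | exact IsDfn.mem (.const hb) (.varS _)
        | exact IsDfn.eq (.varP _) (.varP _)
        | apply IsDfn.and
        | apply IsDfn.not
        | apply IsDfn.imp
        | apply IsDfn.allP hcX hce
        | apply IsDfn.exP hcX hce
        | apply IsDfn.allS
        | apply IsDfn.exS)
    -- A genuine reservoir serves as witness, with `f` sending each term of an enumeration to the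
    -- next one.
    (by
      obtain ⟨S, c, hSc, hS⟩ := exists_isReservoir hF hDd p b
      have := hSc.to_subtype
      have := (hS.flexible.infinite ⟨p, hS.left_mem⟩).to_subtype
      obtain ⟨h⟩ : Nonempty (ℕ ≃ S) := nonempty_equiv_of_countable
      refine ⟨⟨_, subsetSet_mem_H he S⟩, ?_⟩
      simp only [hrel]
      simp only [toH, mem_subsetSet]
      refine ⟨fun u hu v hvu hv => ?_, fun u v huv hu => hS.flexible.isUpperSet huv hu,
        fun u hu b hb ⟨b', hbb', hδ⟩ => ?_, hS.left_mem, hS.right_mem, hS.dense, ⟨c, fun s hs => ?_⟩,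
        ⟨_, relSet_mem_H hθ hP he fun a b => ∃ n, a = (h n : Q L F g) ∧ b = h (n + 1)⟩, ?_, h 0, ?_⟩
      · obtain ⟨i, rfl⟩ := exists_eq_snoc hvu hv
        exact hS.flexible.snoc_mem u hu i
      · exact hS.flexible.exists_le u hu b hb (hδ ▸ (le_iff.1 hbb').1)
      · have hlt := hS.lt_length s hs
        exact ⟨c.restrict s.δ hlt.le, lt_iff.2 ⟨c.le_restrict _, hlt⟩, rfl⟩
      · intro a b b' hab hab'
        rw [pair_mem_relSet] at hab hab'
        obtain ⟨n, rfl, rfl⟩ := hab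
        obtain ⟨n', hn, rfl⟩ := hab'
        exact Subtype.ext (by rw [h.injective (Subtype.ext hn)])
      · intro Z h0 hZ s hs
        have : ∀ n, e (h n) ∈ (Z : ZFSet) := fun n => by
          induction n with
          | zero => exact h0
          | succ n ih =>
            refine hZ _ (h (n + 1)) ih ?_
            rw [pair_mem_relSet]
            exact ⟨n, rfl, rfl⟩
        simpa using this (h.symm ⟨s, hs⟩))
  -- The bound, the function and its starting point are in turn found inside `X`.
  obtain ⟨c, hc, hSc⟩ := IsDfn.exists_mem_cond hcX hce (X := X) (em := toH he)
    (χ := fun c => ∀ s, (toH he s : ZFSet) ∈ (S : ZFSet) →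
        ∃ c', c < c' ∧ ZFSet.pair (toH he s) (toH he c') ∈ (r : ZFSet))
    (by
      repeat' first
        | exact IsDfn.lt hθ hl hle (.varP _) (.varP _)
        | exact IsDfn.pair_mem hθ (.varP _) (.varP _) (.const hr)
        | exact IsDfn.mem (.varP _) (.const hS)
        | apply IsDfn.and
        | apply IsDfn.imp
        | apply IsDfn.allP hcX hce
        | apply IsDfn.exP hcX hce) hbound
  obtain ⟨f, hf, hfun, hgen⟩ := IsDfn.exists_mem_set (X := X) (em := toH he)
    (χ := fun f => (∀ a b b', ZFSet.pair (toH he a) (toH he b) ∈ (f : ZFSet) →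
          ZFSet.pair (toH he a) (toH he b') ∈ (f : ZFSet) → toH he b = toH he b') ∧
        ∃ u, ∀ Z : H θ, (toH he u : ZFSet) ∈ (Z : ZFSet) →
          (∀ a b, (toH he a : ZFSet) ∈ (Z : ZFSet) →
            ZFSet.pair (toH he a) (toH he b) ∈ (f : ZFSet) → (toH he b : ZFSet) ∈ (Z : ZFSet)) →
          ∀ s, (toH he s : ZFSet) ∈ (S : ZFSet) → (toH he s : ZFSet) ∈ (Z : ZFSet))
    (by
      repeat' first
        | exact IsDfn.pair_mem hθ (.varP _) (.varP _) (.varS _)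
        | exact IsDfn.mem (.varP _) (.varS _)
        | exact IsDfn.mem (.varP _) (.const hS)
        | exact IsDfn.eq (.varP _) (.varP _)
        | apply IsDfn.and
        | apply IsDfn.imp
        | apply IsDfn.allP hcX hce
        | apply IsDfn.exP hcX hce
        | apply IsDfn.allS) hgen
  obtain ⟨u, hu, hgen⟩ := IsDfn.exists_mem_cond hcX hce (X := X) (em := toH he)
    (χ := fun u => ∀ Z : H θ, (toH he u : ZFSet) ∈ (Z : ZFSet) →
          (∀ a b, (toH he a : ZFSet) ∈ (Z : ZFSet) →
            ZFSet.pair (toH he a) (toH he b) ∈ (f : ZFSet) → (toH he b : ZFSet) ∈ (Z : ZFSet)) →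
          ∀ s, (toH he s : ZFSet) ∈ (S : ZFSet) → (toH he s : ZFSet) ∈ (Z : ZFSet))
    (by
      repeat' first
        | exact IsDfn.pair_mem hθ (.varP _) (.varP _) (.const hf)
        | exact IsDfn.mem (.varP _) (.varS _)
        | exact IsDfn.mem (.varP _) (.const hS)
        | apply IsDfn.imp
        | apply IsDfn.allP hcX hce
        | apply IsDfn.allS) hgen
  -- Test generation on `Z = P ∩ X`, which is in `H θ` though perhaps not in `X`. It is closed under
  -- `f`: for `a` in `X` some value of `f` at `a` lies in `X`, and the value is unique.
  have hSX : ∀ s, (toH he s : ZFSet) ∈ (S : ZFSet) → toH he s ∈ X := fun s hs => by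
    have := hgen ⟨_, subsetSet_mem_H he {p | toH he p ∈ X}⟩ ((mem_subsetSet e).2 hu)
      (fun a b ha hab => (mem_subsetSet e).2 ?_) s hs
    · exact (mem_subsetSet e).1 this
    · have ha : toH he a ∈ X := (mem_subsetSet e).1 ha
      obtain ⟨b', hb', hab'⟩ := IsDfn.exists_mem_cond hcX hce (X := X) (em := toH he)
        (χ := fun b => ZFSet.pair (toH he a) (toH he b) ∈ (f : ZFSet))
        (IsDfn.pair_mem hθ (.const ha) (.varP _) (.const hf)) ⟨b, hab⟩
      rw [← hfun a b b' hab hab'] at hb'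
      exact hb'
  simp only [hrel] at hext hSc
  refine ⟨{s | (toH he s : ZFSet) ∈ (S : ZFSet)}, hSX, c, hc, ⟨⟨fun u hu i => ?_,
    fun u v huv hu => hup u v huv hu, fun u hu b hb hub => ?_⟩, hpS, hbS, hdense, fun s hs => ?_⟩⟩
  · exact hsucc u hu _ (u.snoc_lt i) (u.not_lt_lt_snoc i)
  · exact hext u hu b hb ⟨b.restrict u.δ hub, b.le_restrict _, rfl⟩
  · obtain ⟨c', hc', hδ⟩ := hSc s hs
    exact hδ ▸ (lt_iff.1 hc').2

end Q

/-- The condition found lies below a member of `D ∩ X` for each dense `D ∈ X`, which is stronger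
than genericity. -/
theorem isProper_Q (hF : IsDenseFn F) : IsProper (Q L F g) := by
  intro e θ hθ _ hP he X X' hX hcX hlX p hp
  replace hP : #(Q L F g) < θ := (cantor _).trans hP
  have hcoe : ∀ y : H θ, (y : ZFSet) ∈ X' → y ∈ X := by
    rintro y ⟨z, hz, hzy⟩
    exact Subtype.ext hzy ▸ hz
  replace hcX : (⟨carrierSet e, he⟩ : H θ) ∈ X := hcoe _ hcX
  obtain ⟨l, hl, hle⟩ := hlX
  let Y : Set (Q L F g) := {p | toH he p ∈ X}
  have hYc : Y.Countable :=
    (hX.preimage_of_injOn e.injective.injOn).mono fun p hp =>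
      Set.mem_image_of_mem Subtype.val (show toH he p ∈ (X : Set (H θ)) from hp)
  let 𝒟 : Set ZFSet := {D ∈ X' | DenseIn {p | e p ∈ D}}
  have h𝒟c : 𝒟.Countable := hX.mono fun _ h => h.1
  -- The whole forcing is a dense set in `X`; nonemptiness permits an enumeration by ℕ.
  have h𝒟 : 𝒟.Nonempty := ⟨carrierSet e, ⟨⟨carrierSet e, he⟩, hcX, rfl⟩, fun q =>
    ⟨q, (mem_carrierSet_iff he (toH he q)).2 ⟨q, rfl⟩, le_rfl⟩⟩
  obtain ⟨D, hD⟩ := h𝒟c.exists_eq_range h𝒟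
  obtain ⟨q, hq, hqD⟩ := Q.exists_le_of_reservoirs hF hYc (D := fun n => {p | e p ∈ D n})
    (fun n p hp b hb => by
      obtain ⟨⟨d, hd, hdD⟩, hdense⟩ : D n ∈ 𝒟 := hD ▸ Set.mem_range_self n
      rw [← hdD] at hdense ⊢
      exact Q.exists_isReservoir_subset hF hθ hP he hcX hl hle hd hdense hp hb)
    (p := p) (hcoe (toH he p) hp)
  refine ⟨q, hq, fun E hEX _ hE r hr => ?_⟩
  obtain ⟨n, rfl⟩ : E ∈ Set.range D := hD ▸ ⟨hEX, hE⟩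
  obtain ⟨d, hdY, hdE, hqd⟩ := hqD n
  exact ⟨d, hdE, ⟨toH he d, hdY, rfl⟩, r, hr.trans hqd, le_rfl⟩

end LadderForcing

open LadderForcing in
theorem mainTheorem7 (L : LadderSystem) (F : (ℕ → Fin 2) →. Fin 2) (hF : IsDenseFn F)
    (g : Omega → Fin 2) :
    IsProper (Q L F g) ∧ OmegaDistributive (Q L F g) ∧ AddsNoNewReals (Q L F g) :=
  ⟨isProper_Q hF, omegaDistributive_Q hF, (omegaDistributive_Q hF).addsNoNewReals⟩
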